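/- **Conventions.** A pseudotopology on a set $S$ is a relation $\mathscr U\to s$ between ultrafilters on $S$ and points of $S$ such that $\dot s\to s$ for every principal ultrafilter $\dot s$; a filter converges to $s$ if every ultrafilter containing it does. A map $f$ of pseudospaces is continuous if $\mathscr U\to s$ implies $f_*\mathscr U\to f(s)$. Topological spaces are pseudospaces via ultrafilter convergence. For pseudospaces $Y,Z$ the exponential $Z^Y$ is the set of continuous maps $Y\to Z$, where $\mathscr F\to g$ iff for all filters $\mathscr G\to y$ in $Y$ one has $\mathrm{ev}_*(\mathscr F\times\mathscr G)\to g(y)$. A pseudotopology is an epitopology if it is initial with respect to a collection of maps into exponentials $Z_j^{Y_j}$ with $Y_j,Z_j$ topological spaces. For a surjection $q\colon L\to S$ from a pseudospace, the quotient pseudotopology (resp. quotient epitopology) on $S$ is the least pseudotopology (resp. epitopology), with respect to inclusion of relations, making $q$ continuous. Let $(X,x_0)$ be a pointed topological space, $\Omega X$ its loop space with the compact-open topology, $\pi_1=\pi_1(X,x_0)$ the set of path components of $\Omega X$ with the group structure induced by concatenation and inversion of loops, and $q\colon\Omega X\to\pi_1$ the projection. Let $\Omega^{\mathrm{ps}}X$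 be the set of loops with the subspace pseudotopology of the exponential $X^{[0,1]}$ (it is also the loop epispace of $X$). On $\pi_1$ consider: - $\pi_1^{\mathrm{ps}}X$, the quotient pseudotopology from $\Omega^{\mathrm{ps}}X$; - $\pi_1^{\mathrm{epi}}X$, the quotient epitopology from $\Omega^{\mathrm{ps}}X$; - $\pi_1^{\mathrm{Biss}}X$, the quotient topology from $\Omega X$; - $\pi_1^{\mathrm{Brazas}}X$, the topology obtained from $\pi_1^{\mathrm{Biss}}X$ by transfinitely iterating the passage from a topology on $\pi_1$ to the quotient topology with respect to the multiplication $\pi_1\times\pi_1\to\pi_1$ (at limit stages one takes the intersection of the previous topologies). A group with an epitopology is an epitopological group if multiplication and inversion are continuous. A quasitopological group is a group with a topology for which inversion is continuous and multiplication is separately continuous. A continuous surjection $f\colon A\to B$ of topological spaces is biquotient if, whenever $b\in B$ and $\mathcal O$ is a family of open subsets of $A$ covering $f^{-1}(b)$, finitely many of the sets $f(O)$, $O\in\mathcal O$, cover a neighbourhood of $b$. **Statement.** For every pointed topological space $X$ the conditions within each of the following lists are equivalent. 1. (a) $\pi_1^{\mathrm{ps}}X$ is an epitopological group; (b) $\pi_1^{\mathrm{ps}}X=\pi_1^{\mathrm{epi}}X$;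 (c) on the set of path components of $\Omega X$ the quotient pseudotopology and the quotient epitopology coincide. 2. (a) $\pi_1^{\mathrm{epi}}X$ is a quasitopological group; (b) $\pi_1^{\mathrm{epi}}X$ is a topological group; (c) $\pi_1^{\mathrm{epi}}X=\pi_1^{\mathrm{Biss}}X$; (d) $\pi_1^{\mathrm{epi}}X=\pi_1^{\mathrm{Brazas}}X$; (e) on the set of path components of $\Omega X$ the quotient epitopology and the quotient topology coincide. 3. (a) $\pi_1^{\mathrm{ps}}X$ is a quasitopological group; (b) $\pi_1^{\mathrm{ps}}X$ is a topological group; (c) $\pi_1^{\mathrm{ps}}X=\pi_1^{\mathrm{Biss}}X$; (d) $\pi_1^{\mathrm{ps}}X=\pi_1^{\mathrm{Brazas}}X$; (e) on the set of path components of $\Omega X$ the quotient pseudotopology and the quotient topology coincide; (f) $q\colon\Omega X\to\pi_1^{\mathrm{Biss}}X$ is biquotient. -/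

import Mathlib

open Filter Topology
open scoped unitInterval

universe u v w

/-! ### Pseudotopological spaces -/

/-- A pseudotopological structure on `α`: a convergence relation between ultrafilters and points
for which every principal ultrafilter converges to its point. -/
@[ext]
structure PsTopology (α : Type u) where
  Conv : Ultrafilter α → α → Prop
  pure_conv : ∀ a, Conv (pure a) a

namespace PsTopology

variable {α : Type u} {β : Type v} {γ : Type w}

/-- The pseudotopology of a topological space: ultrafilter convergence. -/
def ofTop (t : TopologicalSpace α) : PsTopology α where
  Conv U a := (U : Filter α) ≤ 𝓝 a
  pure_conv a := pure_le_nhds a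

/-- A topological space `α`, with its given topology, as a pseudospace. -/
abbrev ofSpace (α : Type u) [t : TopologicalSpace α] : PsTopology α := ofTop t

/-- Convergence of arbitrary filters in a pseudospace. -/
def FConv (s : PsTopology α) (F : Filter α) (a : α) : Prop :=
  ∀ U : Ultrafilter α, (U : Filter α) ≤ F → s.Conv U a

/-- Continuity of maps between pseudospaces. -/
def Cont (s : PsTopology α) (t : PsTopology β) (f : α → β) : Prop :=
  ∀ (U : Ultrafilter α) (a : α), s.Conv U a → t.Conv (U.map f) (f a)

/-- The set of continuous maps between two pseudospaces. -/
abbrev Hom (s : PsTopology α) (t : PsTopology β) : Type (max u v) :=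
  {f : α → β // Cont s t f}

/-- The initial pseudotopology with respect to a family of maps into pseudospaces. -/
def initial {J : Type w} {β : J → Type v} (t : ∀ j, PsTopology (β j)) (f : ∀ j, α → β j) :
    PsTopology α where
  Conv U a := ∀ j, (t j).Conv (U.map (f j)) (f j a)
  pure_conv a j := by
    rw [Ultrafilter.map_pure]
    exact (t j).pure_conv _

/-- The final pseudotopology (quotient pseudotopology if `f` is surjective) with respect to a
map out of a pseudospace. -/
def final (s : PsTopology α) (f : α → β) : PsTopology β where
  Conv V b := (∃ (U : Ultrafilter α) (a : α), s.Conv U a ∧ U.map f = V ∧ f a = b) ∨ V = pure b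
  pure_conv _ := Or.inr rfl

/-- The product pseudotopology on `α × β`. -/
def prod (s : PsTopology α) (t : PsTopology β) : PsTopology (α × β) where
  Conv W p := s.Conv (W.map Prod.fst) p.1 ∧ t.Conv (W.map Prod.snd) p.2
  pure_conv p := by
    rw [Ultrafilter.map_pure, Ultrafilter.map_pure]
    exact ⟨s.pure_conv _, t.pure_conv _⟩

/-- The exponential pseudotopology on the set of continuous maps between two pseudospaces. -/
def exp (s : PsTopology α) (t : PsTopology β) : PsTopology (Hom s t) where
  Conv U f := ∀ (G : Filter α) (a : α), s.FConv G a →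
    t.FConv (((U : Filter (Hom s t)) ×ˢ G).map fun p => p.1.1 p.2) (f.1 a)
  pure_conv f G a hG V hV := by
    have hV' : (V : Filter β) ≤ G.map f.1 := by
      simpa [Ultrafilter.coe_pure, pure_prod, Filter.map_map, Function.comp_def] using hV
    have hne : (comap f.1 (V : Filter β) ⊓ G).NeBot := by
      rw [← map_neBot_iff f.1, Filter.push_pull', inf_eq_left.2 hV']
      exact V.neBot
    have hW := Ultrafilter.of_le (comap f.1 (V : Filter β) ⊓ G)
    have hmap : (Ultrafilter.of (comap f.1 (V : Filter β) ⊓ G)).map f.1 = V := by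
      apply Ultrafilter.coe_le_coe.1
      exact (Filter.map_mono (hW.trans inf_le_left)).trans Filter.map_comap_le
    rw [← hmap]
    exact f.2 _ _ (hG _ (hW.trans inf_le_right))

/-- For topological spaces, continuity of maps between the associated pseudospaces is ordinary
continuity. -/
theorem cont_ofTop_iff [TopologicalSpace α] [TopologicalSpace β] {f : α → β} :
    Cont (ofSpace α) (ofSpace β) f ↔ Continuous f :=
  ⟨fun h => continuous_iff_ultrafilter.2 fun a U hU => h U a hU,
    fun h U a hU => continuous_iff_ultrafilter.1 h a U hU⟩

/-! ### Epitopological spaces -/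

/-- A pseudospace is epitopological if it carries the initial pseudotopology with respect to a
collection of maps into exponentials `Z ^ Y` of topological spaces. -/
def IsEpi (s : PsTopology α) : Prop :=
  ∃ (J : Type (u + 1)) (Y Z : J → Type u) (tY : ∀ j, TopologicalSpace (Y j))
    (tZ : ∀ j, TopologicalSpace (Z j)) (f : ∀ j, α → Hom (ofTop (tY j)) (ofTop (tZ j))),
    s = initial (fun j => exp (ofTop (tY j)) (ofTop (tZ j))) f

/-- The final epitopology (quotient epitopology if `f` is surjective) with respect to a map out of
a pseudospace: the least epitopology making `f` continuous. -/
def finalEpi (s : PsTopology α) (f : α → β) : PsTopology β where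
  Conv V b := ∀ t : PsTopology β, t.IsEpi → Cont s t f → t.Conv V b
  pure_conv b t _ _ := t.pure_conv b

theorem cont_finalEpi (s : PsTopology α) (f : α → β) : Cont s (finalEpi s f) f :=
  fun U a hU _ _ hf => hf U a hU

theorem isEpi_finalEpi (s : PsTopology α) (f : α → β) : (finalEpi s f).IsEpi := by
  classical
  have key : ∀ t : {t : PsTopology β // t.IsEpi ∧ Cont s t f}, t.1.IsEpi := fun t => t.2.1
  choose J Y Z iY iZ g hg using key
  refine ⟨Σ t : {t : PsTopology β // t.IsEpi ∧ Cont s t f}, J t, fun j => Y j.1 j.2,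
    fun j => Z j.1 j.2, fun j => iY j.1 j.2, fun j => iZ j.1 j.2, fun j => g j.1 j.2, ?_⟩
  ext V b
  constructor
  · rintro h ⟨t, j⟩
    have := h t.1 t.2.1 t.2.2
    rw [hg t] at this
    exact this j
  · intro h t ht hf
    have := hg ⟨t, ht, hf⟩
    dsimp only at this
    rw [this]
    exact fun j => h ⟨⟨t, ht, hf⟩, j⟩

/-! ### Groups with a pseudotopology -/

variable {G : Type u} [Group G]

/-- The group `G` with the epitopology `s` is an epitopological group. -/
structure IsEpiTopGroup (s : PsTopology G) : Prop where
  isEpi : s.IsEpi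
  cont_mul : Cont (s.prod s) s fun p => p.1 * p.2
  cont_inv : Cont s s fun g => g⁻¹

/-- The group `G` with the pseudotopology `s` is a quasitopological group: `s` is a topology for
which inversion is continuous and multiplication is separately continuous. -/
def IsQTopGroup (s : PsTopology G) : Prop :=
  ∃ t : TopologicalSpace G, s = ofTop t ∧ ContinuousInv G ∧ SeparatelyContinuousMul G

/-- The group `G` with the pseudotopology `s` is a topological group. -/
def IsTopGroup (s : PsTopology G) : Prop :=
  ∃ t : TopologicalSpace G, s = ofTop t ∧ IsTopologicalGroup G

end PsTopology

/-! ### Biquotient maps -/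

/-- A continuous surjection `f` is biquotient if, whenever a family `O` of open sets covers a fibre
`f ⁻¹ {y}`, finitely many of the images of its members cover a neighbourhood of `y`. -/
structure IsBiquotientMap {α : Type u} {β : Type v} [TopologicalSpace α] [TopologicalSpace β]
    (f : α → β) : Prop where
  continuous : Continuous f
  surjective : Function.Surjective f
  finite_cover : ∀ (y : β) (O : Set (Set α)), (∀ V ∈ O, IsOpen V) → f ⁻¹' {y} ⊆ ⋃₀ O →
    ∃ T ⊆ O, T.Finite ∧ (⋃ V ∈ T, f '' V) ∈ 𝓝 y

/-! ### The group of path components of the loop space -/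

section Loops

variable (X : Type u) [TopologicalSpace X] (x : X)

/-- Two loops lie in the same path component of the loop space iff they are homotopic. -/
theorem joined_loop_iff {X : Type u} [TopologicalSpace X] {x : X} {p q : Path x x} :
    Joined p q ↔ p.Homotopic q := by
  constructor
  · rintro ⟨γ⟩
    refine ⟨⟨⟨⟨fun s => γ s.1 s.2, ?_⟩, ?_, ?_⟩, ?_⟩⟩
    · exact Path.continuous_uncurry_iff.2 γ.continuous
    · intro t; simp
    · intro t; simp
    · intro t s hs
      rcases hs with rfl | rfl <;> simp
  · rintro ⟨F⟩
    refine ⟨⟨⟨fun t => F.eval t, ?_⟩, by simp, by simp⟩⟩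
    apply Path.continuous_uncurry_iff.1
    exact F.continuous

/-- The set of path components of the loop space `Ω(X, x)`, where `Path x x` carries the
compact-open topology. -/
def LoopPi0 : Type u := ZerothHomotopy (Path x x)

variable {X x} in
/-- The projection of the loop space onto its set of path components. -/
def LoopPi0.mk (p : Path x x) : LoopPi0 X x := ZerothHomotopy.mk p

/-- The fundamental group: path components of the loop space under concatenation and inversion of
loops. -/
noncomputable instance : Group (LoopPi0 X x) where
  mul := Quotient.map₂ Path.trans fun _ _ h _ _ h' =>
    joined_loop_iff.2 ((joined_loop_iff.1 h).hcomp (joined_loop_iff.1 h'))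
  one := LoopPi0.mk (Path.refl x)
  inv := Quotient.map Path.symm fun _ _ h => joined_loop_iff.2 (joined_loop_iff.1 h).symm₂
  mul_assoc := by
    rintro ⟨p⟩ ⟨q⟩ ⟨r⟩
    exact Quotient.sound (joined_loop_iff.2 ⟨Path.Homotopy.transAssoc p q r⟩)
  one_mul := by
    rintro ⟨p⟩
    exact Quotient.sound (joined_loop_iff.2 ⟨Path.Homotopy.reflTrans p⟩)
  mul_one := by
    rintro ⟨p⟩
    exact Quotient.sound (joined_loop_iff.2 ⟨Path.Homotopy.transRefl p⟩)
  inv_mul_cancel := by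
    rintro ⟨p⟩
    exact Quotient.sound (joined_loop_iff.2 ⟨(Path.Homotopy.reflSymmTrans p).symm⟩)

/-! ### The loop pseudospace -/

/-- The loop pseudospace of `X`, which for a topological space is also its loop epispace: the set
of loops with the subspace structure inherited from the exponential pseudotopology on `X ^ [0,1]`. -/
def loopPs : PsTopology (Path x x) :=
  PsTopology.initial (J := Unit) (fun _ =>
      PsTopology.exp (PsTopology.ofSpace I)
        (PsTopology.ofSpace X))
    fun _ p => ⟨p, PsTopology.cont_ofTop_iff.2 p.continuous⟩

/-- The loop pseudospace of a topological space is its loop space. -/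
theorem loopPs_eq_ofTop : loopPs X x = PsTopology.ofSpace (Path x x) := by
  have hmap : ∀ (F : Filter (Path x x)) (G : Filter I),
      map (fun z : PsTopology.Hom (PsTopology.ofSpace I) (PsTopology.ofSpace X) × I => z.1.1 z.2)
        (map (fun p : Path x x => ⟨p, PsTopology.cont_ofTop_iff.2 p.continuous⟩) F ×ˢ G) =
      map (fun z : Path x x × I => z.1 z.2) (F ×ˢ G) := by
    intro F G
    rw [Filter.prod_map_left, Filter.map_map]
    rfl
  ext U p
  constructor
  · intro h
    have h1 := h ()
    have key : ∀ t : I, Tendsto (fun z : Path x x × I => z.1 z.2)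
        ((U : Filter (Path x x)) ×ˢ 𝓝 t) (𝓝 (p t)) := by
      intro t
      refine Filter.le_iff_ultrafilter.2 fun V hV => ?_
      refine h1 (𝓝 t) t (fun W hW => hW) V (hV.trans ?_)
      exact (hmap _ _).ge
    change (U : Filter (Path x x)) ≤ 𝓝 p
    rw [nhds_induced, ← map_le_iff_le_comap]
    refine ContinuousMap.tendsto_nhds_compactOpen.2 fun K hK W hW hpW => ?_
    refine hK.induction_on (p := fun s => ∀ᶠ q : Path x x in (U : Filter (Path x x)),
      Set.MapsTo q s W) ?_ ?_ ?_ ?_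
    · exact Eventually.of_forall fun q => Set.mapsTo_empty _ _
    · exact fun s t hst ht => ht.mono fun q hq => hq.mono_left hst
    · exact fun s t hs ht => (hs.and ht).mono fun q hq => hq.1.union hq.2
    · intro t ht
      have h2 := key t (hW.mem_nhds (hpW ht))
      obtain ⟨A, hA, B, hB, hAB⟩ := Filter.mem_prod_iff.1 h2
      exact ⟨B, mem_nhdsWithin_of_mem_nhds hB, Filter.mem_of_superset hA fun q hq s hs =>
        hAB (Set.mk_mem_prod hq hs)⟩
  · intro h _ G t hG V hV
    have hG' : G ≤ 𝓝 t := Filter.le_iff_ultrafilter.2 fun W hW => hG W hW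
    refine hV.trans ?_
    have hev : Tendsto (fun z : Path x x × I => z.1 z.2) (𝓝 p ×ˢ 𝓝 t) (𝓝 (p t)) := by
      rw [← nhds_prod_eq]
      exact (Path.continuous_uncurry_iff.2 (continuous_id (X := Path x x))).tendsto (p, t)
    exact (hmap _ _).le.trans (hev.mono_left (Filter.prod_mono h hG'))

/-- The path components of the loop pseudospace are those of the loop space, so that `LoopPi0 X x`
is also the set of path components of the former. -/
theorem joined_loopPs_iff {X : Type u} [TopologicalSpace X] {x : X} {p q : Path x x} :
    (∃ γ : I → Path x x, PsTopology.Cont (PsTopology.ofSpace I) (loopPs X x) γ ∧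
      γ 0 = p ∧ γ 1 = q) ↔
      Joined p q := by
  simp only [loopPs_eq_ofTop, PsTopology.cont_ofTop_iff]
  constructor
  · rintro ⟨γ, hγ, rfl, rfl⟩
    exact ⟨⟨⟨γ, hγ⟩, rfl, rfl⟩⟩
  · rintro ⟨γ⟩
    exact ⟨γ, γ.continuous, γ.source, γ.target⟩

/-! ### The four structures on the fundamental group -/

/-- The pseudotopological fundamental group. -/
def piPs : PsTopology (LoopPi0 X x) := (loopPs X x).final LoopPi0.mk

/-- The epitopological fundamental group. -/
def piEpi : PsTopology (LoopPi0 X x) := (loopPs X x).finalEpi LoopPi0.mk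

/-- Biss's topology: the quotient topology on the path components of the loop space. -/
@[reducible] def bissTopology : TopologicalSpace (LoopPi0 X x) :=
  TopologicalSpace.coinduced LoopPi0.mk inferInstance

end Loops

/-- The quotient topology on `G` with respect to the multiplication `G × G → G`, as an operator on
topologies (finer topologies are smaller). -/
def mulQuotient (G : Type u) [Group G] : TopologicalSpace G →o TopologicalSpace G where
  toFun t := TopologicalSpace.coinduced (fun p : G × G => p.1 * p.2)
    (@instTopologicalSpaceProd G G t t)
  monotone' s t h := by
    apply coinduced_mono
    exact inf_le_inf (induced_mono h) (induced_mono h)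

/-- Brazas's topology: starting from Biss's topology, iterate transfinitely the passage to the
quotient topology with respect to multiplication, taking at limit stages the finest topology
coarser than all previous ones. -/
@[reducible] noncomputable def brazasTopology (X : Type u) [TopologicalSpace X] (x : X) :
    TopologicalSpace (LoopPi0 X x) :=
  ⨆ a : Ordinal.{u}, OrdinalApprox.lfpApprox (mulQuotient (LoopPi0 X x)) (bissTopology X x) a

/-!
Since the loop pseudospace of `X` is the topological space `Path x x`, all four structures are
final structures along one surjection `q : Path x x → π₁`, and the theorem compares them through
multiplication.

* In pseudospaces a product of two surjective final maps is final (`exists_ultrafilter_prod`), so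
  multiplication is always continuous for `piPs`, and so is inversion. Hence `piPs` is an
  epitopological group as soon as it is an epitopology, which means that it agrees with the least
  epitopology `piEpi`.
* Epitopological spaces are closed under exponentiation by topological spaces, because
  `(Z ^ Y) ^ B = Z ^ (B × Y)`. So the product of a final epitopology with a *topological* space `B`
  is again final among epitopological spaces (`cont_finalEpi_prod`). If `piEpi` happens to be a
  topology, this applies to both factors of `π₁ × π₁`, and multiplication is continuous.
* Every topology is an epitopology, so if `piPs` or `piEpi` is a topology, this can only be the
  final topology, that of Biss. In that case it is a group topology by the above, and is therefore
  fixed by `mulQuotient`, so that Brazas's topology is the same.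
  Conversely Brazas's topology is a fixed point of `mulQuotient`, hence always a group topology.
* A continuous surjection is biquotient iff every ultrafilter converging downstairs is the image of
  one converging to a point of the fibre, that is, iff the target carries the final pseudotopology.
-/

/-! ### Lifting ultrafilters -/

/-- An ultrafilter finer than the image of a filter is the image of an ultrafilter finer than that
filter. -/
theorem exists_ultrafilter_map_eq {α : Type u} {β : Type v} {f : α → β} {F : Filter α}
    {V : Ultrafilter β} (hV : (V : Filter β) ≤ F.map f) :
    ∃ U : Ultrafilter α, (U : Filter α) ≤ F ∧ U.map f = V := by
  have hne : (comap f (V : Filter β) ⊓ F).NeBot := by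
    rw [← map_neBot_iff f, Filter.push_pull', inf_eq_left.2 hV]
    exact V.neBot
  obtain ⟨U, hU⟩ := Ultrafilter.exists_le (comap f (V : Filter β) ⊓ F)
  refine ⟨U, hU.trans inf_le_right, Ultrafilter.coe_le_coe.1 ?_⟩
  exact (Filter.map_mono (hU.trans inf_le_left)).trans Filter.map_comap_le

/-- Lifts of the two marginals of an ultrafilter on a product come from a common lift of that
ultrafilter. -/
theorem exists_ultrafilter_prod {α : Type u} {β : Type v} {q : α → β} {W : Ultrafilter (β × β)}
    {U₁ U₂ : Ultrafilter α} (h₁ : U₁.map q = W.map Prod.fst) (h₂ : U₂.map q = W.map Prod.snd) :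
    ∃ V : Ultrafilter (α × α), V.map Prod.fst = U₁ ∧ V.map Prod.snd = U₂ ∧
      V.map (Prod.map q q) = W := by
  have hle : (W : Filter (β × β)) ≤
      ((U₁ : Filter α) ×ˢ (U₂ : Filter α)).map (Prod.map q q) := by
    rw [← Filter.prod_map_map_eq', ← Ultrafilter.coe_map, ← Ultrafilter.coe_map, h₁, h₂]
    exact Filter.le_prod.2 ⟨le_rfl, le_rfl⟩
  obtain ⟨V, hV, hVW⟩ := exists_ultrafilter_map_eq hle
  obtain ⟨hV₁, hV₂⟩ := Filter.le_prod.1 hV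
  exact ⟨V, Ultrafilter.coe_le_coe.1 hV₁, Ultrafilter.coe_le_coe.1 hV₂, hVW⟩

namespace PsTopology

/-! ### Continuity, products and exponentials -/

section

variable {α : Type u} {β : Type v} {γ : Type w}

theorem Cont.comp {r : PsTopology α} {s : PsTopology β} {t : PsTopology γ} {g : β → γ} {f : α → β}
    (hg : Cont s t g) (hf : Cont r s f) : Cont r t (g ∘ f) := fun U a hU => by
  rw [← Ultrafilter.map_map]
  exact hg _ _ (hf U a hU)

theorem Cont.swap {s : PsTopology α} {t : PsTopology β} {r : PsTopology γ} {f : α × β → γ}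
    (hf : Cont (s.prod t) r f) : Cont (t.prod s) r fun p => f p.swap :=
  hf.comp (r := t.prod s) (f := Prod.swap) fun _ _ h => ⟨h.2, h.1⟩

theorem ofTop_prod (s : TopologicalSpace α) (t : TopologicalSpace β) :
    ofTop (@instTopologicalSpaceProd α β s t) = (ofTop s).prod (ofTop t) := by
  ext W p
  change (W : Filter (α × β)) ≤ 𝓝 p ↔ _
  rw [nhds_prod_eq, Filter.le_prod]
  rfl

theorem cont_ofTop_ofTop_iff {s : TopologicalSpace α} {t : TopologicalSpace β} {f : α → β} :
    Cont (ofTop s) (ofTop t) f ↔ Continuous[s, t] f :=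
  cont_ofTop_iff

theorem Conv.fConv {s : PsTopology α} {U : Ultrafilter α} {a : α} (h : s.Conv U a) :
    s.FConv (U : Filter α) a := fun V hV => by
  rwa [Ultrafilter.coe_le_coe.1 hV]

theorem Cont.uncurry {δ : Type*} {r : PsTopology δ} {s : PsTopology α} {t : PsTopology β}
    {k : δ → Hom s t} (hk : Cont r (exp s t) k) :
    Cont (r.prod s) t fun p => (k p.1).1 p.2 := by
  rintro W ⟨d, a⟩ ⟨hd, ha⟩
  refine hk _ _ hd _ _ (Conv.fConv ha) _ ?_
  have hW : (W : Filter (δ × α)) ≤ (W.map Prod.fst : Filter δ) ×ˢ (W.map Prod.snd : Filter α) :=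
    Filter.le_prod.2 ⟨le_rfl, le_rfl⟩
  rw [Ultrafilter.coe_map k, Filter.prod_map_left, Filter.map_map]
  exact Filter.map_mono hW

theorem Cont.curry {δ : Type*} {r : PsTopology δ} {s : PsTopology α} {t : PsTopology β}
    {k : δ → Hom s t} (hk : Cont (r.prod s) t fun p => (k p.1).1 p.2) :
    Cont r (exp s t) k := by
  intro U d hU G a hG V hV
  rw [Ultrafilter.coe_map k, Filter.prod_map_left, Filter.map_map] at hV
  obtain ⟨W, hW, rfl⟩ := exists_ultrafilter_map_eq hV
  obtain ⟨h₁, h₂⟩ := Filter.le_prod.1 hW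
  refine hk W (d, a) ⟨?_, hG (W.map Prod.snd) h₂⟩
  have hWU : W.map Prod.fst = U := Ultrafilter.coe_le_coe.1 h₁
  rwa [hWU]

end

/-! ### Final structures -/

section

variable {α β : Type u} {s : PsTopology α} {q : α → β}

theorem cont_final (s : PsTopology α) (q : α → β) : Cont s (final s q) q :=
  fun U a hU => Or.inl ⟨U, a, hU, rfl, rfl⟩

theorem Cont.final_conv {t : PsTopology β} (h : Cont s t q) {V : Ultrafilter β} {b : β}
    (hV : (final s q).Conv V b) : t.Conv V b := by
  rcases hV with ⟨U, a, hU, rfl, rfl⟩ | rfl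
  · exact h U a hU
  · exact t.pure_conv b

/-- For a surjection, the principal ultrafilters need no separate clause. -/
theorem final_conv_iff (hq : Function.Surjective q) {V : Ultrafilter β} {b : β} :
    (final s q).Conv V b ↔ ∃ (U : Ultrafilter α) (a : α), s.Conv U a ∧ U.map q = V ∧ q a = b := by
  refine ⟨?_, Or.inl⟩
  rintro (h | rfl)
  · exact h
  · obtain ⟨a, rfl⟩ := hq b
    exact ⟨pure a, a, s.pure_conv a, Ultrafilter.map_pure _ _, rfl⟩

/-- A topology `t` is the initial structure along the evident map into `t ^ {*}`. -/
theorem isEpi_ofTop (t : TopologicalSpace β) : (ofTop t).IsEpi := by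
  let c : β → Hom (ofSpace PUnit.{u + 1}) (ofTop t) := fun b =>
    ⟨fun _ => b, cont_ofTop_iff.2 continuous_const⟩
  refine ⟨PUnit, fun _ => PUnit, fun _ => β, fun _ => inferInstance, fun _ => t, fun _ => c, ?_⟩
  ext V b
  constructor
  · intro h _
    have hc : Cont (ofTop t) (exp (ofSpace PUnit.{u + 1}) (ofTop t)) c :=
      Cont.curry fun W p hW => hW.1
    exact hc V b h
  · intro h
    have := h PUnit.unit (pure PUnit.unit) PUnit.unit
      (Conv.fConv ((ofSpace PUnit.{u + 1}).pure_conv _)) V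
    refine this ?_
    rw [Ultrafilter.coe_map c, Filter.prod_map_left, Filter.map_map, prod_pure, Filter.map_map]
    exact Filter.map_id.ge

theorem Cont.finalEpi_desc {t : PsTopology β} (ht : t.IsEpi) (h : Cont s t q) :
    Cont (finalEpi s q) t id := fun _ _ hU => hU t ht h

theorem final_eq_finalEpi_iff : final s q = finalEpi s q ↔ (final s q).IsEpi := by
  refine ⟨fun h => h ▸ isEpi_finalEpi s q, fun h => ?_⟩
  ext V b
  exact ⟨fun hV => (cont_finalEpi s q).final_conv hV, fun hV => hV _ h (cont_final s q)⟩

theorem cont_coinduced [tα : TopologicalSpace α] (q : α → β) :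
    Cont (ofSpace α) (ofTop (TopologicalSpace.coinduced q tα)) q :=
  cont_ofTop_ofTop_iff.2 continuous_coinduced_rng

/-- If the final pseudotopology is a topology, it is the final topology. -/
theorem eq_coinduced_of_final_eq [tα : TopologicalSpace α] {t : TopologicalSpace β}
    (h : final (ofSpace α) q = ofTop t) : t = TopologicalSpace.coinduced q tα := by
  apply le_antisymm
  · refine continuous_id_iff_le.1 (cont_ofTop_ofTop_iff.1 fun V b hV => ?_)
    rw [← h] at hV
    exact (cont_coinduced q).final_conv hV
  · have hc := cont_final (ofSpace α) q
    rw [h] at hc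
    exact continuous_iff_coinduced_le.1 (cont_ofTop_ofTop_iff.1 hc)

/-- If the final epitopology is a topology, it is the final topology. -/
theorem eq_coinduced_of_finalEpi_eq [tα : TopologicalSpace α] {t : TopologicalSpace β}
    (h : finalEpi (ofSpace α) q = ofTop t) : t = TopologicalSpace.coinduced q tα := by
  apply le_antisymm
  · have hc := (cont_coinduced q).finalEpi_desc (isEpi_ofTop _)
    rw [h] at hc
    exact continuous_id_iff_le.1 (cont_ofTop_ofTop_iff.1 hc)
  · have hc := cont_finalEpi (ofSpace α) q
    rw [h] at hc
    exact continuous_iff_coinduced_le.1 (cont_ofTop_ofTop_iff.1 hc)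

/-- The product of a final epitopology with a topological space is final among epitopological
spaces: a map out of it is continuous if its composite with `q × id` is. -/
theorem cont_finalEpi_prod {γ B : Type u} (hq : Function.Surjective q) {T : PsTopology γ}
    (hT : T.IsEpi) (tB : TopologicalSpace B) {h : β × B → γ}
    (hh : Cont (s.prod (ofTop tB)) T fun p => h (q p.1, p.2)) :
    Cont ((finalEpi s q).prod (ofTop tB)) T h := by
  obtain ⟨J, Y, Z, tY, tZ, f, rfl⟩ := hT
  -- Move the parameter `b` into the exponent: `(Z ^ Y) ^ B = Z ^ (B × Y)`.
  have huncurry : ∀ j, Cont (s.prod (ofTop (@instTopologicalSpaceProd B (Y j) tB (tY j))))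
      (ofTop (tZ j)) fun p => (f j (h (q p.1, p.2.1))).1 p.2.2 := by
    intro j
    have hj : Cont (s.prod (ofTop tB)) (exp (ofTop (tY j)) (ofTop (tZ j)))
        fun p => f j (h (q p.1, p.2)) := fun W p hW => by
      have := hh W p hW j
      rwa [Ultrafilter.map_map] at this
    rw [ofTop_prod]
    exact hj.uncurry.comp (f := fun p : α × B × Y j => ((p.1, p.2.1), p.2.2))
      fun W p hW => ⟨⟨hW.1, hW.2.1⟩, hW.2.2⟩
  have hslice : ∀ j b, Cont (ofTop (@instTopologicalSpaceProd B (Y j) tB (tY j)))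
      (ofTop (tZ j)) fun p => (f j (h (b, p.1))).1 p.2 := by
    intro j b
    obtain ⟨a, rfl⟩ := hq b
    refine (huncurry j).comp (f := fun p : B × Y j => (a, p)) fun W p hW => ⟨?_, ?_⟩
    · rw [Ultrafilter.map_map]
      have : W.map (Prod.fst ∘ fun p : B × Y j => (a, p)) = pure a :=
        Ultrafilter.coe_inj.1 (Filter.map_const (f := (W : Filter (B × Y j))) (c := a))
      rw [this]
      exact s.pure_conv a
    · rw [Ultrafilter.map_map]
      exact hW
  let k : ∀ j, β → Hom (ofTop (@instTopologicalSpaceProd B (Y j) tB (tY j))) (ofTop (tZ j)) :=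
    fun j b => ⟨_, hslice j b⟩
  -- The maps `k j` define an epitopology on `β` for which `q` is continuous.
  have hk : Cont s (initial (fun j => exp (ofTop (@instTopologicalSpaceProd B (Y j) tB (tY j)))
      (ofTop (tZ j))) k) q := fun U a hU j => by
    rw [Ultrafilter.map_map]
    exact Cont.curry (k := k j ∘ q) (huncurry j) U a hU
  have hepi := hk.finalEpi_desc ⟨J, _, Z, _, tZ, k, rfl⟩
  intro W p hW j
  rw [Ultrafilter.map_map]
  have hkj : Cont (finalEpi s q) (exp (ofTop (@instTopologicalSpaceProd B (Y j) tB (tY j)))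
      (ofTop (tZ j))) (k j) := fun U b hU => hepi U b hU j
  have hu : Cont ((finalEpi s q).prod ((ofTop tB).prod (ofTop (tY j)))) (ofTop (tZ j))
      fun p => (f j (h (p.1, p.2.1))).1 p.2.2 := by
    rw [← ofTop_prod]
    exact hkj.uncurry
  refine Cont.curry (k := f j ∘ h) ?_ W p hW
  exact hu.comp (f := fun p : (β × B) × Y j => (p.1.1, (p.1.2, p.2)))
    fun W p hW => ⟨hW.1.1, hW.1.2, hW.2⟩

end

/-- A topological group is quasitopological. -/
theorem IsTopGroup.isQTopGroup {G : Type u} [Group G] {s : PsTopology G} (h : s.IsTopGroup) :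
    s.IsQTopGroup := by
  obtain ⟨t, rfl, _⟩ := h
  exact ⟨t, rfl, inferInstance, inferInstance⟩

end PsTopology

/-! ### Biquotient maps -/

/-- A quotient map is biquotient iff its target carries the final pseudotopology, that is, iff
convergent ultrafilters lift to convergent ultrafilters. -/
theorem isBiquotientMap_coinduced_iff {α β : Type u} [tα : TopologicalSpace α] {q : α → β}
    (hq : Function.Surjective q) :
    @IsBiquotientMap α β tα (TopologicalSpace.coinduced q tα) q ↔
      (PsTopology.ofSpace α).final q = PsTopology.ofTop (TopologicalSpace.coinduced q tα) := by
  let : TopologicalSpace β := TopologicalSpace.coinduced q tα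
  have hcont : Continuous q := continuous_coinduced_rng
  constructor
  · intro hbi
    ext V b
    refine ⟨fun hV => (PsTopology.cont_ofTop_iff.2 hcont).final_conv hV, fun hV => ?_⟩
    rw [PsTopology.final_conv_iff hq]
    by_contra! hno
    -- Without a lift of `V`, each point of the fibre has an open neighbourhood whose image
    -- is not in `V`.
    have hcov : q ⁻¹' {b} ⊆ ⋃₀ {O : Set α | IsOpen O ∧ q '' O ∉ V} := by
      intro a ha
      have hle : ¬ (V : Filter β) ≤ (𝓝 a).map q := fun hle => by
        obtain ⟨U, hU, hUV⟩ := exists_ultrafilter_map_eq hle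
        exact hno U a hU hUV ha
      obtain ⟨S, hS, hSV⟩ := Filter.not_le.1 hle
      obtain ⟨O, hOS, hO, haO⟩ := mem_nhds_iff.1 (Filter.mem_map.1 hS)
      exact ⟨O, ⟨hO, fun hOV => hSV (Filter.mem_of_superset hOV (Set.image_subset_iff.2 hOS))⟩,
        haO⟩
    obtain ⟨T, hT, hfin, hmem⟩ := hbi.finite_cover b _ (fun _ hO => hO.1) hcov
    obtain ⟨O, hO, hOV⟩ := (Ultrafilter.finite_biUnion_mem_iff hfin).1 (hV hmem)
    exact (hT hO).2 hOV
  · intro h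
    refine ⟨hcont, hq, fun b 𝒪 hopen hcov => ?_⟩
    by_contra! hno
    -- The complements of finite unions of images, together with the neighbourhoods of `b`,
    -- generate a proper filter.
    have hne : (𝓝 b ⊓ ⨅ O ∈ 𝒪, 𝓟 (q '' O)ᶜ).NeBot := by
      rw [Filter.neBot_iff]
      intro hbot
      have hdisj := Filter.disjoint_iff.1 (disjoint_iff.2 hbot)
      obtain ⟨S, hS, R, hR, hSR⟩ := hdisj
      rw [Filter.mem_biInf_principal] at hR
      obtain ⟨T, hfin, hT, hTR⟩ := hR
      refine hno T hT hfin (Filter.mem_of_superset hS fun y hy => ?_)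
      by_contra hy'
      refine Set.disjoint_left.1 hSR hy (hTR ?_)
      simpa using hy'
    obtain ⟨V, hV⟩ := Ultrafilter.exists_le (𝓝 b ⊓ ⨅ O ∈ 𝒪, 𝓟 (q '' O)ᶜ)
    have hVb : (PsTopology.ofSpace β).Conv V b := hV.trans inf_le_left
    rw [PsTopology.ofSpace, ← h, PsTopology.final_conv_iff hq] at hVb
    obtain ⟨U, a, hU, rfl, ha⟩ := hVb
    obtain ⟨O, hO, haO⟩ := hcov (show a ∈ q ⁻¹' {b} from ha)
    have hOU : q '' O ∈ U.map q :=
      Filter.mem_of_superset (f := (U : Filter α)) (hU ((hopen O hO).mem_nhds haO))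
        (Set.subset_preimage_image q O)
    refine Ultrafilter.compl_mem_iff_notMem.1 (hV (Filter.mem_inf_of_right ?_)) hOU
    exact Filter.mem_iInf_of_mem O (Filter.mem_iInf_of_mem hO (Filter.mem_principal_self _))

/-! ### Iterating the quotient by multiplication -/

section MulQuotient

variable {G : Type u} [Group G]

theorem le_mulQuotient (t : TopologicalSpace G) : t ≤ mulQuotient G t := by
  let := t
  have h : Continuous[t, mulQuotient G t] fun g : G => g * 1 :=
    @Continuous.comp _ _ _ _ _ (mulQuotient G t) _ (fun p : G × G => p.1 * p.2)
      continuous_coinduced_rng (continuous_id.prodMk continuous_const)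
  simp only [mul_one] at h
  exact continuous_id_iff_le.1 h

theorem mulQuotient_eq_self_iff (t : TopologicalSpace G) :
    mulQuotient G t = t ↔ @ContinuousMul G t _ := by
  let := t
  refine ⟨fun h => ⟨continuous_iff_coinduced_le.2 h.le⟩, fun h => ?_⟩
  exact le_antisymm (continuous_iff_coinduced_le.1 continuous_mul) (le_mulQuotient t)

theorem continuous_inv_mulQuotient {t : TopologicalSpace G}
    (h : Continuous[t, t] fun g : G => g⁻¹) :
    Continuous[mulQuotient G t, mulQuotient G t] fun g : G => g⁻¹ := by
  let := t
  refine continuous_coinduced_dom.2 ?_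
  have : (fun g : G => g⁻¹) ∘ (fun p : G × G => p.1 * p.2) =
      (fun p : G × G => p.1 * p.2) ∘ fun p => (p.2⁻¹, p.1⁻¹) := by
    ext p
    simp
  rw [this]
  exact @Continuous.comp _ _ _ _ _ (mulQuotient G t) _ (fun p : G × G => p.1 * p.2)
    continuous_coinduced_rng ((h.comp continuous_snd).prodMk (h.comp continuous_fst))

theorem continuous_inv_lfpApprox {t : TopologicalSpace G}
    (h : Continuous[t, t] fun g : G => g⁻¹) (a : Ordinal.{u}) :
    Continuous[OrdinalApprox.lfpApprox (mulQuotient G) t a,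
      OrdinalApprox.lfpApprox (mulQuotient G) t a] fun g : G => g⁻¹ := by
  induction a using WellFoundedLT.induction with
  | ind a ih =>
    nth_rewrite 1 [OrdinalApprox.lfpApprox]
    refine continuous_sup_dom.2 ⟨continuous_le_rng (OrdinalApprox.le_lfpApprox _) h, ?_⟩
    refine continuous_iSup_dom.2 fun b => continuous_iSup_dom.2 fun hb => ?_
    exact continuous_le_rng (OrdinalApprox.apply_lfpApprox_le_lfpApprox_of_lt _ hb)
      (continuous_inv_mulQuotient (ih b hb))

end MulQuotient

/-! ### The topologies on the fundamental group -/

section FundamentalGroup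

open PsTopology

variable (X : Type u) [TopologicalSpace X] (x : X)

theorem LoopPi0.mk_surjective : Function.Surjective (LoopPi0.mk : Path x x → LoopPi0 X x) :=
  Quotient.mk_surjective

theorem piPs_eq : piPs X x = (ofSpace (Path x x)).final LoopPi0.mk := by
  rw [piPs, loopPs_eq_ofTop]

theorem piEpi_eq : piEpi X x = (ofSpace (Path x x)).finalEpi LoopPi0.mk := by
  rw [piEpi, loopPs_eq_ofTop]

/-- A convergent ultrafilter on `π₁ × π₁` lifts to a convergent ultrafilter of pairs of loops, where
concatenation is continuous. -/
theorem cont_mul_piPs : Cont ((piPs X x).prod (piPs X x)) (piPs X x) fun p => p.1 * p.2 := by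
  rw [piPs_eq]
  rintro W ⟨g, h⟩ ⟨hg, hh⟩
  rw [final_conv_iff (LoopPi0.mk_surjective X x)] at hg hh
  obtain ⟨U₁, p, hp, hU₁, rfl⟩ := hg
  obtain ⟨U₂, r, hr, hU₂, rfl⟩ := hh
  obtain ⟨V, rfl, rfl, rfl⟩ := exists_ultrafilter_prod hU₁ hU₂
  refine Or.inl ⟨V.map fun z => z.1.trans z.2, p.trans r, ?_, ?_, rfl⟩
  · have hV : (ofSpace (Path x x × Path x x)).Conv V (p, r) := by
      rw [ofSpace, ofTop_prod]
      exact ⟨hp, hr⟩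
    exact cont_ofTop_iff.2 Path.continuous_trans V _ hV
  · rw [Ultrafilter.map_map, Ultrafilter.map_map]
    rfl

theorem cont_inv_piPs : Cont (piPs X x) (piPs X x) fun g => g⁻¹ := by
  rw [piPs_eq]
  intro V g hV
  rw [final_conv_iff (LoopPi0.mk_surjective X x)] at hV
  obtain ⟨U, p, hp, rfl, rfl⟩ := hV
  refine Or.inl ⟨U.map Path.symm, p.symm, cont_ofTop_iff.2 Path.continuous_symm U p hp, ?_, rfl⟩
  rw [Ultrafilter.map_map, Ultrafilter.map_map]
  rfl

theorem continuousMul_of_cont {G : Type u} [Group G] {t : TopologicalSpace G}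
    (h : Cont ((ofTop t).prod (ofTop t)) (ofTop t) fun p : G × G => p.1 * p.2) :
    ContinuousMul G := by
  rw [← ofTop_prod] at h
  exact ⟨cont_ofTop_iff.1 h⟩

/-- If the final epitopology is a topology, its multiplication is continuous: one factor of
`Path x x × Path x x` at a time is replaced by its quotient, the other one being topological. -/
theorem continuousMul_biss_of_piEpi_eq (h : piEpi X x = ofTop (bissTopology X x)) :
    @ContinuousMul (LoopPi0 X x) (bissTopology X x) _ := by
  have hsurj := LoopPi0.mk_surjective X x
  rw [piEpi_eq] at h
  have hepi := isEpi_ofTop (bissTopology X x)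
  have hpaths : Cont ((ofSpace (Path x x)).prod (ofSpace (Path x x))) (ofTop (bissTopology X x))
      fun p => LoopPi0.mk p.1 * LoopPi0.mk p.2 := by
    rw [ofSpace, ← ofTop_prod]
    exact (cont_coinduced LoopPi0.mk).comp (cont_ofTop_iff.2 Path.continuous_trans)
  have hleft := cont_finalEpi_prod hsurj hepi _
    (h := fun p : LoopPi0 X x × Path x x => p.1 * LoopPi0.mk p.2) hpaths
  rw [h] at hleft
  have hboth := cont_finalEpi_prod hsurj hepi _
    (h := fun p : LoopPi0 X x × LoopPi0 X x => p.2 * p.1) hleft.swap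
  rw [h] at hboth
  exact continuousMul_of_cont hboth.swap

theorem continuous_inv_biss :
    Continuous[bissTopology X x, bissTopology X x] fun g : LoopPi0 X x => g⁻¹ := by
  refine continuous_coinduced_dom.2 ?_
  exact @Continuous.comp _ _ _ _ _ (bissTopology X x) _ LoopPi0.mk continuous_coinduced_rng
    Path.continuous_symm

theorem brazasTopology_eq_nextFixed :
    brazasTopology X x = ((mulQuotient (LoopPi0 X x)).nextFixed (bissTopology X x)
      (le_mulQuotient _)).1 :=
  (OrdinalApprox.nextFixed_eq_iSup_lfpApprox _ _).symm

theorem isTopologicalGroup_brazas :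
    @IsTopologicalGroup (LoopPi0 X x) (brazasTopology X x) _ := by
  let := brazasTopology X x
  have hmul : ContinuousMul (LoopPi0 X x) := by
    rw [← mulQuotient_eq_self_iff]
    change mulQuotient (LoopPi0 X x) (brazasTopology X x) = brazasTopology X x
    rw [brazasTopology_eq_nextFixed]
    exact Subtype.prop ((mulQuotient (LoopPi0 X x)).nextFixed (bissTopology X x) _)
  have hinv : ContinuousInv (LoopPi0 X x) := by
    refine ⟨continuous_iSup_dom.2 fun a => ?_⟩
    exact continuous_le_rng (le_iSup _ a) (continuous_inv_lfpApprox (continuous_inv_biss X x) a)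
  exact {}

theorem brazasTopology_eq_biss (h : @ContinuousMul (LoopPi0 X x) (bissTopology X x) _) :
    brazasTopology X x = bissTopology X x := by
  rw [brazasTopology_eq_nextFixed]
  have hfix := (mulQuotient_eq_self_iff _).2 h
  exact le_antisymm
    (OrderHom.nextFixed_le (y := ⟨bissTopology X x, hfix⟩) _ _ le_rfl)
    (OrderHom.le_nextFixed _ _)

/-- The common part of the characterisations of when `piPs` and `piEpi` are topologies: all that is
used about the structure is that the only topology it can be is that of Biss, and that
multiplication is continuous in this case. -/
theorem tfae_of_eq_biss {P : PsTopology (LoopPi0 X x)}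
    (huniq : ∀ t, P = ofTop t → t = bissTopology X x)
    (hmul : P = ofTop (bissTopology X x) → @ContinuousMul (LoopPi0 X x) (bissTopology X x) _) :
    List.TFAE [P.IsQTopGroup, P.IsTopGroup, P = ofTop (bissTopology X x),
      P = ofTop (brazasTopology X x)] := by
  tfae_have 2 → 1 := IsTopGroup.isQTopGroup
  tfae_have 1 → 3 := by
    rintro ⟨t, ht, -⟩
    rwa [← huniq t ht]
  tfae_have 3 → 4 := fun h => by rwa [brazasTopology_eq_biss X x (hmul h)]
  tfae_have 4 → 2 := fun h => ⟨_, h, isTopologicalGroup_brazas X x⟩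
  tfae_finish

end FundamentalGroup

theorem mainTheorem5 (X : Type u) [TopologicalSpace X] (x : X) :
    List.TFAE [
      (piPs X x).IsEpiTopGroup,
      piPs X x = piEpi X x,
      (PsTopology.ofSpace (Path x x)).final (LoopPi0.mk : Path x x → LoopPi0 X x) =
        (PsTopology.ofSpace (Path x x)).finalEpi (LoopPi0.mk : Path x x → LoopPi0 X x)] ∧
    List.TFAE [
      (piEpi X x).IsQTopGroup,
      (piEpi X x).IsTopGroup,
      piEpi X x = PsTopology.ofTop (bissTopology X x),
      piEpi X x = PsTopology.ofTop (brazasTopology X x),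
      (PsTopology.ofSpace (Path x x)).finalEpi (LoopPi0.mk : Path x x → LoopPi0 X x) =
        PsTopology.ofTop
          (TopologicalSpace.coinduced (LoopPi0.mk : Path x x → LoopPi0 X x) inferInstance)] ∧
    List.TFAE [
      (piPs X x).IsQTopGroup,
      (piPs X x).IsTopGroup,
      piPs X x = PsTopology.ofTop (bissTopology X x),
      piPs X x = PsTopology.ofTop (brazasTopology X x),
      (PsTopology.ofSpace (Path x x)).final (LoopPi0.mk : Path x x → LoopPi0 X x) =
        PsTopology.ofTop
          (TopologicalSpace.coinduced (LoopPi0.mk : Path x x → LoopPi0 X x) inferInstance),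
      @IsBiquotientMap (Path x x) (LoopPi0 X x) inferInstance (bissTopology X x) LoopPi0.mk] := by
  have hPs := tfae_of_eq_biss X x (P := piPs X x)
    (fun t ht => PsTopology.eq_coinduced_of_final_eq (piPs_eq X x ▸ ht))
    (fun h => continuousMul_of_cont (h ▸ cont_mul_piPs X x))
  have hEpi := tfae_of_eq_biss X x (P := piEpi X x)
    (fun t ht => PsTopology.eq_coinduced_of_finalEpi_eq (piEpi_eq X x ▸ ht))
    (continuousMul_biss_of_piEpi_eq X x)
  have hbi := isBiquotientMap_coinduced_iff (LoopPi0.mk_surjective X x)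
  have hgroup : (piPs X x).IsEpiTopGroup ↔ (piPs X x).IsEpi :=
    ⟨fun h => h.isEpi, fun h => ⟨h, cont_mul_piPs X x, cont_inv_piPs X x⟩⟩
  have hepi : piPs X x = piEpi X x ↔ (piPs X x).IsEpi := PsTopology.final_eq_finalEpi_iff
  rw [← piPs_eq, ← piEpi_eq]
  rw [← piPs_eq] at hbi
  refine ⟨?_, ?_, ?_⟩
  · tfae_have 1 ↔ 2 := hgroup.trans hepi.symm
    tfae_have 2 ↔ 3 := Iff.rfl
    tfae_finish
  · tfae_have 1 ↔ 2 := hEpi.out 0 1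
    tfae_have 2 ↔ 3 := hEpi.out 1 2
    tfae_have 3 ↔ 4 := hEpi.out 2 3
    tfae_have 3 ↔ 5 := Iff.rfl
    tfae_finish
  · tfae_have 1 ↔ 2 := hPs.out 0 1
    tfae_have 2 ↔ 3 := hPs.out 1 2
    tfae_have 3 ↔ 4 := hPs.out 2 3
    tfae_have 3 ↔ 5 := Iff.rfl
    tfae_have 6 ↔ 5 := hbi
    tfae_finish
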